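/- Let $K$ be a field of characteristic zero and let $n\ge 2$ be an integer. For $0\le i<n$ let $K[x,y]_i$ be the linear span of all monomials of $K[x,y]$ whose total degree is $i+ns$ for some integer $s\ge 0$, and put $K[y]_1=K[x,y]_1\cap K[y]$. A derivation $D$ of $K[x,y]$ (over $K$) is called $n$-graded if $D(x),D(y)\in K[x,y]_1$, and locally nilpotent if for every $a\in K[x,y]$ there is a positive integer $m$ with $D^m(a)=0$. A $K$-algebra automorphism $\varphi$ of $K[x,y]$ is called $n$-graded if $\varphi(x),\varphi(y)\in K[x,y]_1$; it is called elementary if either $\varphi(x)=x$ and $\varphi(y)=cy+g(x)$, or $\varphi(x)=cx+g(y)$ and $\varphi(y)=y$, where $0\ne c\in K$ and $g$ is a polynomial in one variable over $K$. A tame $n$-graded automorphism is an $n$-graded automorphism that is a finite product (composition) of $n$-graded elementary automorphisms. Let $D$ be a locally nilpotent $n$-graded derivation of $K[x,y]$. Then there exist a tame $n$-graded automorphism $\alpha$ of $K[x,y]$ and $f(y)\in K[y]_1$ such that $$\alpha^{-1}D\alpha=f(y)\,\partial_x .$$ -/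

import Mathlib

noncomputable section

open MvPolynomial

/-- The polynomial algebra `K[x,y]`; the variable `x` is `X 0` and the variable `y` is `X 1`. -/
abbrev PolyXY (K : Type*) [Field K] := MvPolynomial (Fin 2) K

/-- The component `K[x,y]_i` (for `0 ≤ i < n`) of the `n`-grading: the linear span of all
monomials whose total degree is `i + n s` for some nonnegative integer `s`. -/
def gradedPart (K : Type*) [Field K] (n i : ℕ) : Submodule K (PolyXY K) :=
  Submodule.span K
    {p | ∃ a b s : ℕ, a + b = i + n * s ∧ p = (X 0 : PolyXY K) ^ a * (X 1 : PolyXY K) ^ b}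

/-- `K[y]_1 = K[x,y]_1 ∩ K[y]`. -/
def gradedPartY (K : Type*) [Field K] (n : ℕ) : Submodule K (PolyXY K) :=
  gradedPart K n 1 ⊓ Subalgebra.toSubmodule (Algebra.adjoin K {(X 1 : PolyXY K)})

/-- A derivation `D` of `K[x,y]` is `n`-graded if `D x` and `D y` lie in `K[x,y]_1`. -/
def IsGradedDerivation {K : Type*} [Field K] (n : ℕ)
    (D : Derivation K (PolyXY K) (PolyXY K)) : Prop :=
  D (X 0) ∈ gradedPart K n 1 ∧ D (X 1) ∈ gradedPart K n 1

/-- A derivation is locally nilpotent if every element is killed by some power of it. -/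
def IsLocallyNilpotentDerivation {K : Type*} [Field K]
    (D : Derivation K (PolyXY K) (PolyXY K)) : Prop :=
  ∀ p : PolyXY K, ∃ m : ℕ, 0 < m ∧ D^[m] p = 0

/-- An automorphism `φ` of `K[x,y]` is `n`-graded if `φ x` and `φ y` lie in `K[x,y]_1`. -/
def IsGradedAut {K : Type*} [Field K] (n : ℕ) (φ : PolyXY K ≃ₐ[K] PolyXY K) : Prop :=
  φ (X 0) ∈ gradedPart K n 1 ∧ φ (X 1) ∈ gradedPart K n 1

/-- Elementary automorphisms `(x, c y + g(x))` and `(c x + g(y), y)` with `c ≠ 0`. -/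
def IsElementaryAut {K : Type*} [Field K] (φ : PolyXY K ≃ₐ[K] PolyXY K) : Prop :=
  ∃ (c : K) (g : Polynomial K), c ≠ 0 ∧
    ((φ (X 0) = X 0 ∧ φ (X 1) = C c * X 1 + Polynomial.aeval (X 0 : PolyXY K) g) ∨
     (φ (X 0) = C c * X 0 + Polynomial.aeval (X 1 : PolyXY K) g ∧ φ (X 1) = X 1))

/-- A tame `n`-graded automorphism: an `n`-graded automorphism that is a (finite) product of
`n`-graded elementary automorphisms. The product is composition, `(φ * ψ) p = φ (ψ p)`. -/
def IsGradedTameAut {K : Type*} [Field K] (n : ℕ) (φ : PolyXY K ≃ₐ[K] PolyXY K) : Prop :=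
  IsGradedAut n φ ∧
    φ ∈ Submonoid.closure
      {ε : PolyXY K ≃ₐ[K] PolyXY K | IsElementaryAut ε ∧ IsGradedAut n ε}

end

/-! This is Rentschler's theorem carried out inside the grading. A locally nilpotent `D` has an
exponential `p ↦ ∑ Dⁱ(p)/i! Tⁱ`, an injective homomorphism into polynomials in `T` (`expHom`). Its
degree in `T`, `nilDeg`, is additive on products, drops by one under `D`, and vanishes exactly on
the kernel. Let a, b be the degrees of x, y, and u, v the leading coefficients of their
exponentials. The proof is by induction on a + b.

If b = 0, then `D` kills y and is f(y)∂ₓ; if a = 0, swap the variables. Otherwise give x, y the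
weights a, b. The kernel contains a nonconstant F (`LocNil.exists_nonconstant_ker`). Its leading
part P is killed by the leading part E of `D`, again locally nilpotent and nonzero. Since the
exponential of F is constant in `T`, P(u, v) = 0 (`exists_leading_relation`). Divisibility arguments
for E and P force a ∣ b or b ∣ a (`dvd_or_dvd_of_relation`).

If b = am, the relation makes v/uᵐ algebraic over `K`, so v = c uᵐ with c in `K`
(`exists_proportional_of_relation`), and y - c xᵐ has smaller degree than y. Because `D` is graded,
u and v lie in the class of 1 modulo `n`, so m ≡ 1 and the shear is graded. Conjugating by it lowers
a + b; the case b ∣ a follows by swapping. -/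

noncomputable section

open MvPolynomial

/-! ### Exponential and degree function of a locally nilpotent derivation. -/

section LocallyNilpotent

variable {K R : Type*} [Field K] [CommRing R] [Algebra K R]

/-- A derivation of a `K`-algebra all of whose elements are killed by some iterate. -/
def LocNil (D : Derivation K R R) : Prop := ∀ p : R, ∃ m : ℕ, D^[m] p = 0

theorem LocNil.iterate_eq_zero {D : Derivation K R R} {p : R} {m k : ℕ} (h : D^[m] p = 0)
    (hk : m ≤ k) : D^[k] p = 0 := by
  obtain ⟨j, rfl⟩ := Nat.exists_eq_add_of_le' hk
  rw [Function.iterate_add_apply, h, iterate_map_zero]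

/-- The polynomial `∑ Dⁱ(p) / i! Tⁱ`. -/
def expPoly (D : Derivation K R R) (hD : LocNil D) (p : R) : Polynomial R :=
  ∑ i ∈ Finset.range (hD p).choose, Polynomial.monomial i ((i.factorial : K)⁻¹ • D^[i] p)

theorem coeff_expPoly (D : Derivation K R R) (hD : LocNil D) (p : R) (i : ℕ) :
    (expPoly D hD p).coeff i = (i.factorial : K)⁻¹ • D^[i] p := by
  simp only [expPoly, Polynomial.finsetSum_coeff, Polynomial.coeff_monomial]
  rw [Finset.sum_ite_eq']
  split_ifs with h
  · rfl
  · rw [LocNil.iterate_eq_zero (hD p).choose_spec (by simpa using h), smul_zero]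

theorem coeff_zero_expPoly (D : Derivation K R R) (hD : LocNil D) (p : R) :
    (expPoly D hD p).coeff 0 = p := by
  simp [coeff_expPoly]

theorem expPoly_add (D : Derivation K R R) (hD : LocNil D) (p q : R) :
    expPoly D hD (p + q) = expPoly D hD p + expPoly D hD q := by
  ext i
  simp [coeff_expPoly, iterate_map_add, smul_add]

theorem expPoly_eq_C (D : Derivation K R R) (hD : LocNil D) {p : R} (h : D p = 0) :
    expPoly D hD p = Polynomial.C p := by
  ext i
  rw [coeff_expPoly, Polynomial.coeff_C]
  rcases i with - | i
  · simp
  · simp [Function.iterate_succ_apply, h]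

variable [CharZero K]

theorem derivative_expPoly (D : Derivation K R R) (hD : LocNil D) (p : R) :
    Polynomial.derivative (expPoly D hD p) = expPoly D hD (D p) := by
  ext i
  rw [Polynomial.coeff_derivative, coeff_expPoly, coeff_expPoly, Function.iterate_succ_apply,
    Nat.factorial_succ]
  have h : ((i : R) + 1) = algebraMap K R (i + 1) := by simp
  have h' : (i : K) + 1 ≠ 0 := Nat.cast_add_one_ne_zero i
  rw [h, mul_comm, ← Algebra.smul_def, smul_smul]
  congr 1
  push_cast
  field_simp

variable [IsDomain R] [CharZero R]

theorem eq_of_derivative_eq {p q : Polynomial R} (h0 : p.coeff 0 = q.coeff 0)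
    (h : Polynomial.derivative p = Polynomial.derivative q) : p = q := by
  ext i
  rcases i with - | i
  · exact h0
  · have := congrArg (fun r => Polynomial.coeff r i) h
    simp only [Polynomial.coeff_derivative] at this
    exact mul_right_cancel₀ (by exact_mod_cast Nat.succ_ne_zero i) this

/-- In characteristic zero a polynomial in `T` is determined by its constant term and its
derivative. The Leibniz rule turns the derivatives into the same identity for pairs of smaller total
nilpotency order, so no binomial formula is needed. -/
theorem expPoly_mul (D : Derivation K R R) (hD : LocNil D) (p q : R) :
    expPoly D hD (p * q) = expPoly D hD p * expPoly D hD q := by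
  obtain ⟨m, hm⟩ := hD p
  obtain ⟨k, hk⟩ := hD q
  obtain ⟨s, hs⟩ : ∃ s, s = m + k := ⟨_, rfl⟩
  induction s using Nat.strong_induction_on generalizing p q m k with
  | _ s ih =>
    rcases m with - | m
    · have : p = 0 := hm
      subst this
      simp [expPoly_eq_C D hD (map_zero D)]
    rcases k with - | k
    · have : q = 0 := hk
      subst this
      simp [expPoly_eq_C D hD (map_zero D)]
    apply eq_of_derivative_eq
    · simp [coeff_zero_expPoly, Polynomial.mul_coeff_zero]
    · rw [derivative_expPoly, Polynomial.derivative_mul, derivative_expPoly, derivative_expPoly,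
        D.leibniz, smul_eq_mul, smul_eq_mul, expPoly_add,
        ih (m + 1 + k) (by omega) p (D q) (m + 1) hm k hk rfl,
        ih (k + 1 + m) (by omega) q (D p) (k + 1) hk m hm rfl]
      ring

/-- The exponential homomorphism `p ↦ ∑ Dⁱ(p) / i! Tⁱ` of a locally nilpotent derivation. -/
def expHom (D : Derivation K R R) (hD : LocNil D) : R →ₐ[K] Polynomial R where
  toFun := expPoly D hD
  map_one' := by rw [expPoly_eq_C D hD D.map_one_eq_zero, map_one]
  map_mul' := expPoly_mul D hD
  map_zero' := by rw [expPoly_eq_C D hD (map_zero D), map_zero]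
  map_add' := expPoly_add D hD
  commutes' r := by rw [expPoly_eq_C D hD (D.map_algebraMap r)]; rfl

theorem coeff_expHom (D : Derivation K R R) (hD : LocNil D) (p : R) (i : ℕ) :
    (expHom D hD p).coeff i = (i.factorial : K)⁻¹ • D^[i] p := coeff_expPoly D hD p i

theorem derivative_expHom (D : Derivation K R R) (hD : LocNil D) (p : R) :
    Polynomial.derivative (expHom D hD p) = expHom D hD (D p) := derivative_expPoly D hD p

theorem expHom_eq_C (D : Derivation K R R) (hD : LocNil D) {p : R} (h : D p = 0) :
    expHom D hD p = Polynomial.C p := expPoly_eq_C D hD h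

theorem expHom_injective (D : Derivation K R R) (hD : LocNil D) :
    Function.Injective (expHom D hD) := fun p q h => by
  have := congrArg (fun r => Polynomial.coeff r 0) h
  simpa [coeff_expHom] using this

theorem expHom_eq_zero_iff (D : Derivation K R R) (hD : LocNil D) {p : R} :
    expHom D hD p = 0 ↔ p = 0 :=
  map_eq_zero_iff _ (expHom_injective D hD)

/-- The degree of an element with respect to a locally nilpotent derivation. -/
def nilDeg (D : Derivation K R R) (hD : LocNil D) (p : R) : ℕ := (expHom D hD p).natDegree

/-- The leading coefficient of the exponential of an element. -/
def nilLead (D : Derivation K R R) (hD : LocNil D) (p : R) : R := (expHom D hD p).leadingCoeff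

theorem nilDeg_map (D : Derivation K R R) (hD : LocNil D) (p : R) :
    nilDeg D hD (D p) = nilDeg D hD p - 1 := by
  rw [nilDeg, ← derivative_expHom, Polynomial.natDegree_derivative, nilDeg]

theorem nilDeg_eq_zero_iff (D : Derivation K R R) (hD : LocNil D) {p : R} :
    nilDeg D hD p = 0 ↔ D p = 0 := by
  constructor
  · intro h
    rw [← expHom_eq_zero_iff D hD, ← derivative_expHom]
    exact Polynomial.derivative_of_natDegree_zero h
  · intro h
    rw [nilDeg, expHom_eq_C D hD h, Polynomial.natDegree_C]

theorem nilDeg_mul (D : Derivation K R R) (hD : LocNil D) {p q : R} (hp : p ≠ 0) (hq : q ≠ 0) :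
    nilDeg D hD (p * q) = nilDeg D hD p + nilDeg D hD q := by
  rw [nilDeg, map_mul, Polynomial.natDegree_mul ((expHom_eq_zero_iff D hD).not.2 hp)
    ((expHom_eq_zero_iff D hD).not.2 hq), nilDeg, nilDeg]

theorem nilLead_eq (D : Derivation K R R) (hD : LocNil D) (p : R) :
    nilLead D hD p = ((nilDeg D hD p).factorial : K)⁻¹ • D^[nilDeg D hD p] p :=
  coeff_expHom D hD p _

theorem nilLead_ne_zero (D : Derivation K R R) (hD : LocNil D) {p : R} (hp : p ≠ 0) :
    nilLead D hD p ≠ 0 :=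
  Polynomial.leadingCoeff_ne_zero.2 ((expHom_eq_zero_iff D hD).not.2 hp)

theorem iterate_succ_nilDeg (D : Derivation K R R) (hD : LocNil D) (p : R) :
    D^[nilDeg D hD p + 1] p = 0 := by
  have h := coeff_expHom D hD p (nilDeg D hD p + 1)
  rw [Polynomial.coeff_eq_zero_of_natDegree_lt (Nat.lt_succ_self (nilDeg D hD p))] at h
  exact (smul_eq_zero.1 h.symm).resolve_left
    (inv_ne_zero (Nat.cast_ne_zero.2 (Nat.factorial_ne_zero _)))

theorem map_nilLead (D : Derivation K R R) (hD : LocNil D) (p : R) :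
    D (nilLead D hD p) = 0 := by
  rw [nilLead_eq, D.map_smul, ← Function.iterate_succ_apply' D, iterate_succ_nilDeg, smul_zero]

/-- An element dividing its own derivative is killed by a locally nilpotent derivation. -/
theorem LocNil.map_eq_zero_of_dvd {D : Derivation K R R} (hD : LocNil D) {p q : R}
    (h : D p = p * q) : D p = 0 := by
  by_contra h0
  have hp : p ≠ 0 := fun hp => h0 (by rw [hp, map_zero])
  have hq : q ≠ 0 := fun hq => h0 (by rw [h, hq, mul_zero])
  -- Degrees conflict: `D p` has degree one less than `p`, while a nonzero multiple of `p` has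
  -- degree at least that of `p`.
  have h1 := nilDeg_map D hD p
  rw [h, nilDeg_mul D hD hp hq] at h1
  have h2 := (nilDeg_eq_zero_iff D hD (p := p)).not.2 h0
  omega

/-- Two elements, each dividing the derivative of the other, have a vanishing derivative. -/
theorem LocNil.map_eq_zero_or_of_dvd {D : Derivation K R R} (hD : LocNil D) {p q : R}
    (hp : p ∣ D q) (hq : q ∣ D p) : D p = 0 ∨ D q = 0 := by
  by_contra! h0
  obtain ⟨r, hr⟩ := hp
  obtain ⟨s, hs⟩ := hq
  -- Each of `p`, `q` would have degree strictly below the other.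
  have h1 := nilDeg_map D hD p
  have h2 := nilDeg_map D hD q
  have hr0 : p ≠ 0 ∧ r ≠ 0 := mul_ne_zero_iff.1 (hr ▸ h0.2)
  have hs0 : q ≠ 0 ∧ s ≠ 0 := mul_ne_zero_iff.1 (hs ▸ h0.1)
  rw [hs, nilDeg_mul D hD hs0.1 hs0.2] at h1
  rw [hr, nilDeg_mul D hD hr0.1 hr0.2] at h2
  have h3 := (nilDeg_eq_zero_iff D hD (p := p)).not.2 h0.1
  have h4 := (nilDeg_eq_zero_iff D hD (p := q)).not.2 h0.2
  omega

/-- The kernel of a locally nilpotent derivation is factorially closed. -/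
theorem LocNil.map_eq_zero_of_dvd_ker {D : Derivation K R R} (hD : LocNil D) {p q : R}
    (hq : D q = 0) (hq0 : q ≠ 0) (h : p ∣ q) : D p = 0 := by
  obtain ⟨r, rfl⟩ := h
  obtain ⟨hp, hr⟩ := mul_ne_zero_iff.1 hq0
  rw [← nilDeg_eq_zero_iff D hD] at hq ⊢
  rw [nilDeg_mul D hD hp hr] at hq
  omega

/-- If the kernel is the base field, the algebra is generated by one element. -/
theorem LocNil.exists_aeval_surjective {D : Derivation K R R} (hD : LocNil D) (hD0 : D ≠ 0)
    (hker : ∀ p, D p = 0 → ∃ c : K, p = algebraMap K R c) :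
    ∃ r : R, Function.Surjective (Polynomial.aeval r : Polynomial K →ₐ[K] R) := by
  obtain ⟨p, hp⟩ : ∃ p, D p ≠ 0 := by
    by_contra! h
    exact hD0 (Derivation.ext h)
  have hdeg := (nilDeg_eq_zero_iff D hD (p := p)).not.2 hp
  obtain ⟨d, hd⟩ := Nat.exists_eq_succ_of_ne_zero hdeg
  have hp0 : p ≠ 0 := fun h => hp (by rw [h, map_zero])
  have hlead := nilLead_ne_zero D hD hp0
  have hDl := map_nilLead D hD p
  obtain ⟨c, hc⟩ := hker _ hDl
  have hc0 : c ≠ 0 := by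
    rintro rfl
    exact hlead (by rw [hc, map_zero])
  -- The last nonzero iterate of `p` is a nonzero constant, so the iterate before it, rescaled, is a
  -- slice.
  obtain ⟨r, hr⟩ : ∃ r, D r = 1 := by
    refine ⟨c⁻¹ • ((nilDeg D hD p).factorial : K)⁻¹ • D^[d] p, ?_⟩
    rw [D.map_smul, D.map_smul, ← Function.iterate_succ_apply' D, ← hd, ← nilLead_eq, hc,
      Algebra.algebraMap_eq_smul_one, smul_smul, inv_mul_cancel₀ hc0, one_smul]
  refine ⟨r, fun f => ?_⟩
  have hint : ∀ g : Polynomial K, ∃ G : Polynomial K, Polynomial.derivative G = g := by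
    intro g
    induction g using Polynomial.induction_on' with
    | add p q hp hq =>
      obtain ⟨P, rfl⟩ := hp
      obtain ⟨Q, rfl⟩ := hq
      exact ⟨P + Q, by simp⟩
    | monomial n a =>
      refine ⟨Polynomial.monomial (n + 1) (a / (n + 1)), ?_⟩
      have : (n : K) + 1 ≠ 0 := Nat.cast_add_one_ne_zero n
      rw [Polynomial.derivative_monomial]
      simp [this]
  obtain ⟨m, hm⟩ := hD f
  -- Write `D f` as a polynomial in the slice and integrate it; what remains of `f` lies in the
  -- kernel, hence in `K`.
  induction m generalizing f with
  | zero => exact ⟨0, by simpa using Eq.symm hm⟩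
  | succ m ih =>
    obtain ⟨g, hg⟩ := ih (D f) hm
    obtain ⟨G, hG⟩ := hint g
    obtain ⟨e, he⟩ := hker (f - Polynomial.aeval r G) (by
      rw [map_sub, D.map_aeval, hG, hg, hr, smul_eq_mul, mul_one, sub_self])
    exact ⟨G + Polynomial.C e, by
      rw [map_add, Polynomial.aeval_C, ← he]; ring⟩

end LocallyNilpotent

/-! ### Weight filtrations and leading parts of derivations. -/

section WeightFiltration

variable {K σ : Type*} [Field K]

/-- Polynomials all of whose monomials have weight at most `k`. -/
abbrev weightLE (K : Type*) {σ : Type*} [Field K] (w : σ → ℤ) (k : ℤ) :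
    Submodule K (MvPolynomial σ K) :=
  restrictSupport K {d | Finsupp.weight w d ≤ k}

theorem mem_weightLE {w : σ → ℤ} {k : ℤ} {f : MvPolynomial σ K} :
    f ∈ weightLE K w k ↔ ∀ d ∈ f.support, Finsupp.weight w d ≤ k := by
  rw [mem_restrictSupport_iff]; rfl

theorem weightLE_mono (w : σ → ℤ) {k l : ℤ} (h : k ≤ l) : weightLE K w k ≤ weightLE K w l :=
  restrictSupport_mono K fun _ hd => le_trans hd h

theorem component_eq_zero_of_mem_weightLE {w : σ → ℤ} {k l : ℤ} {f : MvPolynomial σ K}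
    (hf : f ∈ weightLE K w k) (h : k < l) : weightedHomogeneousComponent w l f = 0 :=
  weightedHomogeneousComponent_eq_zero' l f fun d hd hl => by
    have := mem_weightLE.1 hf d hd
    omega

theorem component_monomial_mul (w : σ → ℤ) (d : σ →₀ ℕ) (c : K) (g : MvPolynomial σ K) (k : ℤ) :
    weightedHomogeneousComponent w (Finsupp.weight w d + k) (monomial d c * g) =
      monomial d c * weightedHomogeneousComponent w k g := by
  classical
  ext m
  rw [coeff_weightedHomogeneousComponent, coeff_monomial_mul', coeff_monomial_mul',
    coeff_weightedHomogeneousComponent]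
  by_cases h : d ≤ m
  · obtain ⟨e, rfl⟩ := exists_add_of_le h
    simp [map_add]
  · simp [h]

theorem monomial_mul_mem_weightLE {w : σ → ℤ} (d : σ →₀ ℕ) (c : K) {g : MvPolynomial σ K} {k : ℤ}
    (hg : g ∈ weightLE K w k) : monomial d c * g ∈ weightLE K w (Finsupp.weight w d + k) := by
  classical
  rw [mem_weightLE] at hg ⊢
  intro m hm
  rw [mem_support_iff, coeff_monomial_mul'] at hm
  by_cases h : d ≤ m
  · obtain ⟨e, rfl⟩ := exists_add_of_le h
    rw [if_pos h, add_tsub_cancel_left] at hm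
    have := hg e (mem_support_iff.2 (right_ne_zero_of_mul hm))
    rw [map_add]
    omega
  · simp [h] at hm

/-- Linear statements about `weightLE` can be checked on monomials. -/
theorem weightLE_induction {w : σ → ℤ} {k : ℤ} {p : MvPolynomial σ K → Prop}
    {f : MvPolynomial σ K} (hf : f ∈ weightLE K w k) (h0 : p 0)
    (hadd : ∀ f g, p f → p g → p (f + g))
    (hmon : ∀ d c, Finsupp.weight w d ≤ k → p (monomial d c)) : p f := by
  rw [f.as_sum]
  exact Finset.sum_induction _ p hadd h0 fun d hd => hmon d _ (mem_weightLE.1 hf d hd)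

theorem derivation_sum_apply {ι A : Type*} [CommRing A] [Algebra K A] (s : Finset ι)
    (D : ι → Derivation K A A) (f : A) : (∑ i ∈ s, D i) f = ∑ i ∈ s, D i f := by
  rw [← Derivation.coeFnAddMonoidHom_apply, map_sum, Finset.sum_apply]
  rfl

theorem derivation_eq_sum_pderiv [Fintype σ] (D : Derivation K (MvPolynomial σ K)
    (MvPolynomial σ K)) (f : MvPolynomial σ K) : D f = ∑ i, pderiv i f * D (X i) := by
  classical
  have h : D = ∑ i, D (X i) • pderiv i := by
    apply derivation_ext
    intro i
    rw [derivation_sum_apply, Finset.sum_eq_single i]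
    · simp
    · intro j _ hj
      simp [pderiv_X_of_ne hj.symm]
    · simp
  have h2 := congrArg (fun E => E f) h
  simp only [derivation_sum_apply, Derivation.smul_apply, smul_eq_mul] at h2
  rw [h2]
  exact Finset.sum_congr rfl fun i _ => mul_comm _ _

/-- The homogeneous part of weight `e` of a derivation. -/
def topDerivation (w : σ → ℤ) (e : ℤ) (D : Derivation K (MvPolynomial σ K) (MvPolynomial σ K)) :
    Derivation K (MvPolynomial σ K) (MvPolynomial σ K) :=
  mkDerivation K fun i => weightedHomogeneousComponent w (w i + e) (D (X i))

theorem topDerivation_X (w : σ → ℤ) (e : ℤ)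
    (D : Derivation K (MvPolynomial σ K) (MvPolynomial σ K)) (i : σ) :
    topDerivation w e D (X i) = weightedHomogeneousComponent w (w i + e) (D (X i)) :=
  mkDerivation_X _ _ _

variable [Fintype σ] {w : σ → ℤ} {e : ℤ} {D : Derivation K (MvPolynomial σ K) (MvPolynomial σ K)}

theorem derivation_monomial_component (hD : ∀ i, D (X i) ∈ weightLE K w (w i + e))
    (d : σ →₀ ℕ) (c : K) :
    D (monomial d c) ∈ weightLE K w (Finsupp.weight w d + e) ∧
      weightedHomogeneousComponent w (Finsupp.weight w d + e) (D (monomial d c)) =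
        topDerivation w e D (monomial d c) := by
  rw [derivation_eq_sum_pderiv D, derivation_eq_sum_pderiv (topDerivation w e D), map_sum]
  have key : ∀ i, pderiv i (monomial d c) = 0 ∨
      Finsupp.weight w d + e = Finsupp.weight w (d - Finsupp.single i 1) + (w i + e) := by
    intro i
    by_cases h : d i = 0
    · left
      rw [pderiv_monomial, h]
      simp
    · right
      have h1 : Finsupp.single i 1 ≤ d := by
        rw [Finsupp.single_le_iff]; omega
      have h2 : Finsupp.weight w d =
          Finsupp.weight w (d - Finsupp.single i 1) + w i := by
        conv_lhs => rw [← tsub_add_cancel_of_le h1, map_add]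
        simp [Finsupp.weight_single]
      omega
  constructor
  · refine Submodule.sum_mem _ fun i _ => ?_
    rcases key i with h | h
    · rw [h, zero_mul]; exact Submodule.zero_mem _
    · rw [h, pderiv_monomial]
      exact monomial_mul_mem_weightLE _ _ (hD i)
  · refine Finset.sum_congr rfl fun i _ => ?_
    rcases key i with h | h
    · rw [h, zero_mul, zero_mul, map_zero]
    · rw [h, pderiv_monomial, component_monomial_mul, topDerivation_X]

/-- Passing to leading parts commutes with applying the derivation. The shift `e` may be negative,
hence integer weights. -/
theorem derivation_component (hD : ∀ i, D (X i) ∈ weightLE K w (w i + e)) {k : ℤ}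
    {f : MvPolynomial σ K} (hf : f ∈ weightLE K w k) :
    D f ∈ weightLE K w (k + e) ∧ weightedHomogeneousComponent w (k + e) (D f) =
      topDerivation w e D (weightedHomogeneousComponent w k f) := by
  classical
  refine weightLE_induction (p := fun f => D f ∈ weightLE K w (k + e) ∧
    weightedHomogeneousComponent w (k + e) (D f) =
      topDerivation w e D (weightedHomogeneousComponent w k f)) hf ?_ ?_ ?_
  · simp
  · rintro f g ⟨hf, hf'⟩ ⟨hg, hg'⟩
    refine ⟨by rw [map_add]; exact Submodule.add_mem _ hf hg, ?_⟩
    simp only [map_add, hf', hg']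
  · intro d c hdk
    obtain ⟨h1, h2⟩ := derivation_monomial_component hD d c
    have h3 := isWeightedHomogeneous_monomial w d c rfl
    refine ⟨weightLE_mono w (by omega) h1, ?_⟩
    rcases hdk.lt_or_eq with h | h
    · rw [component_eq_zero_of_mem_weightLE h1 (by omega),
        h3.weightedHomogeneousComponent_ne k h.ne', map_zero]
    · rw [← h, h2, h3.weightedHomogeneousComponent_same]

theorem iterate_derivation_component (hD : ∀ i, D (X i) ∈ weightLE K w (w i + e)) {k : ℤ}
    {f : MvPolynomial σ K} (hf : f ∈ weightLE K w k) (j : ℕ) :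
    D^[j] f ∈ weightLE K w (k + j * e) ∧ weightedHomogeneousComponent w (k + j * e) (D^[j] f) =
      (topDerivation w e D)^[j] (weightedHomogeneousComponent w k f) := by
  induction j with
  | zero => simpa using hf
  | succ j ih =>
    obtain ⟨h1, h2⟩ := derivation_component hD ih.1
    rw [Function.iterate_succ_apply', Function.iterate_succ_apply', ← ih.2, ← h2]
    have : k + (j + 1 : ℕ) * e = k + j * e + e := by push_cast; ring
    rw [this]
    exact ⟨h1, rfl⟩

/-- On a monomial, the iterates of the leading part are components of the iterates of `D`, so they
vanish as soon as the latter do. -/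
theorem LocNil.topDerivation (hnil : LocNil D) (hD : ∀ i, D (X i) ∈ weightLE K w (w i + e)) :
    LocNil (topDerivation w e D) := by
  intro f
  induction f using MvPolynomial.induction_on' with
  | monomial d c =>
    obtain ⟨m, hm⟩ := hnil (monomial d c)
    refine ⟨m, ?_⟩
    have h3 := isWeightedHomogeneous_monomial w d c rfl
    have h := (iterate_derivation_component hD (k := Finsupp.weight w d) (f := monomial d c)
      (by rw [monomial_mem_restrictSupport]; left; exact le_refl (Finsupp.weight w d)) m).2
    rwa [hm, map_zero, h3.weightedHomogeneousComponent_same, eq_comm] at h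
  | add p q hp hq =>
    obtain ⟨m, hm⟩ := hp
    obtain ⟨k, hk⟩ := hq
    refine ⟨m + k, ?_⟩
    rw [iterate_map_add, LocNil.iterate_eq_zero hm (by omega),
      LocNil.iterate_eq_zero hk (by omega), add_zero]

end WeightFiltration

/-! ### Weights and divisibility by a variable in K[x,y]. -/

section TwoVariables

variable {K R : Type*} [Field K] [CommRing R] [Algebra K R]

/-- The weight with values `a` on `X 0` and `b` on `X 1`. -/
def pairWeight (a b : ℕ) : Fin 2 → ℤ := ![(a : ℤ), (b : ℤ)]

theorem weight_pairWeight (a b : ℕ) (d : Fin 2 →₀ ℕ) :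
    Finsupp.weight (pairWeight a b) d = a * d 0 + b * d 1 := by
  rw [Finsupp.weight_apply, Finsupp.sum_fintype _ _ (by simp)]
  simp [pairWeight, Fin.sum_univ_two, mul_comm]

theorem aeval_monomial_pair (q : Fin 2 → R) (d : Fin 2 →₀ ℕ) (c : K) :
    aeval q (monomial d c) = algebraMap K R c * (q 0 ^ d 0 * q 1 ^ d 1) := by
  rw [aeval_monomial, Finsupp.prod_fintype _ _ (by simp), Fin.prod_univ_two]

/-- Only monomials of weight exactly `k` can reach degree `k` in `T`, and each contributes the
product of the top coefficients. -/
theorem coeff_algHom_eq_aeval_component {a b : ℕ} (ψ : PolyXY K →ₐ[K] Polynomial R)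
    (ha : (ψ (X 0)).natDegree ≤ a) (hb : (ψ (X 1)).natDegree ≤ b) {k : ℕ} {f : PolyXY K}
    (hf : f ∈ weightLE K (pairWeight a b) k) :
    (ψ f).coeff k = aeval ![(ψ (X 0)).coeff a, (ψ (X 1)).coeff b]
      (weightedHomogeneousComponent (pairWeight a b) k f) := by
  classical
  refine weightLE_induction (p := fun f => (ψ f).coeff k =
    aeval ![(ψ (X 0)).coeff a, (ψ (X 1)).coeff b]
      (weightedHomogeneousComponent (pairWeight a b) k f)) hf (by simp) ?_ ?_
  · intro f g hf hg
    simp only [map_add, Polynomial.coeff_add, hf, hg]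
  · intro d c hdk
    have h3 := isWeightedHomogeneous_monomial (pairWeight a b) d c rfl
    have hψ : ψ (monomial d c) = Polynomial.C (algebraMap K R c) *
        (ψ (X 0) ^ d 0 * ψ (X 1) ^ d 1) := by
      have h := aeval_unique ψ
      conv_lhs => rw [h, aeval_monomial_pair]
      rfl
    have hd0 : (ψ (X 0) ^ d 0).natDegree ≤ d 0 * a := Polynomial.natDegree_pow_le_of_le _ ha
    have hd1 : (ψ (X 1) ^ d 1).natDegree ≤ d 1 * b := Polynomial.natDegree_pow_le_of_le _ hb
    rw [weight_pairWeight] at hdk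
    rw [hψ, Polynomial.coeff_C_mul]
    rcases hdk.lt_or_eq with h | h
    · have hlt : d 0 * a + d 1 * b < k := by
        rw [mul_comm (d 0), mul_comm (d 1)]
        exact_mod_cast h
      rw [Polynomial.coeff_eq_zero_of_natDegree_lt
        ((Polynomial.natDegree_mul_le_of_le hd0 hd1).trans_lt hlt),
        h3.weightedHomogeneousComponent_ne (k : ℤ) (by rw [weight_pairWeight]; exact h.ne'),
        mul_zero, map_zero]
    · have heq : k = d 0 * a + d 1 * b := by
        rw [mul_comm (d 0), mul_comm (d 1)]
        exact_mod_cast h.symm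
      have h4 : weightedHomogeneousComponent (pairWeight a b) (k : ℤ) (monomial d c) =
          monomial d c := by
        rw [← h, ← weight_pairWeight, h3.weightedHomogeneousComponent_same]
      rw [h4, heq, Polynomial.coeff_mul_add_eq_of_natDegree_le hd0 hd1,
        Polynomial.coeff_pow_of_natDegree_le ha, Polynomial.coeff_pow_of_natDegree_le hb,
        aeval_monomial_pair]
      simp

theorem X_dvd_of_forall {i : Fin 2} {f : PolyXY K} (h : ∀ d ∈ f.support, d i ≠ 0) :
    (X i : PolyXY K) ∣ f := by
  rw [f.as_sum]
  exact Finset.dvd_sum fun d hd => X_dvd_monomial.2 (Or.inr (h d hd))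

theorem ne_zero_of_X_dvd {i : Fin 2} {f : PolyXY K} (h : (X i : PolyXY K) ∣ f) :
    ∀ d ∈ f.support, d i ≠ 0 := by
  classical
  obtain ⟨g, rfl⟩ := h
  intro d hd hd0
  rw [mem_support_iff, coeff_X_mul'] at hd
  simp [hd0] at hd

end TwoVariables

/-! ### The leading relation and its consequences for the two degrees. -/

section Leading

variable {K : Type*} [Field K]

/-- The shift `e` is the maximum of the weight of m minus `w j`, over all monomials m of `D (X j)`
and all `j`. -/
theorem exists_topDerivation_ne_zero {σ : Type*} [Fintype σ] (w : σ → ℤ)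
    {D : Derivation K (MvPolynomial σ K) (MvPolynomial σ K)} (hD : D ≠ 0) :
    ∃ e, (∀ i, D (X i) ∈ weightLE K w (w i + e)) ∧ topDerivation w e D ≠ 0 := by
  classical
  obtain ⟨i, hi⟩ : ∃ i, D (X i) ≠ 0 := by
    by_contra! h
    exact hD (derivation_ext fun i => by rw [h i]; rfl)
  obtain ⟨d, hd⟩ := support_nonempty.2 hi
  obtain ⟨⟨j, m⟩, hjm, hmax⟩ := Finset.exists_max_image
    (Finset.univ.sigma fun i => (D (X i)).support)
    (fun s => Finsupp.weight w s.2 - w s.1) ⟨⟨i, d⟩, by simpa using hd⟩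
  simp only [Finset.mem_sigma, Finset.mem_univ, true_and] at hjm hmax
  refine ⟨Finsupp.weight w m - w j, fun i => mem_weightLE.2 fun d hd => ?_, fun h => ?_⟩
  · have := hmax ⟨i, d⟩ hd
    simp only at this
    omega
  · have h1 := congrArg (fun E => coeff m (E (X j))) h
    simp only [topDerivation_X, coeff_weightedHomogeneousComponent] at h1
    rw [if_pos (by ring)] at h1
    exact (mem_support_iff.1 hjm) h1

theorem MvPolynomial.IsWeightedHomogeneous.pair {a b k : ℕ} {P : PolyXY K}
    (hP : IsWeightedHomogeneous (pairWeight a b) P (k : ℤ)) :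
    ∀ d ∈ P.support, a * d 0 + b * d 1 = k := by
  intro d hd
  have := hP (mem_support_iff.1 hd)
  rw [weight_pairWeight] at this
  exact_mod_cast this

theorem derivation_eq_pair (E : Derivation K (PolyXY K) (PolyXY K)) (P : PolyXY K) :
    E P = pderiv 0 P * E (X 0) + pderiv 1 P * E (X 1) := by
  rw [derivation_eq_sum_pderiv, Fin.sum_univ_two]

theorem derivation_eq_zero_pair {E : Derivation K (PolyXY K) (PolyXY K)} (h0 : E (X 0) = 0)
    (h1 : E (X 1) = 0) : E = 0 :=
  derivation_ext fun i => by fin_cases i <;> assumption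

/-- The exponents of the nonzero monomials of a partial derivative. -/
theorem exponent_of_mem_support_pderiv {i : Fin 2} {P : PolyXY K} {d : Fin 2 →₀ ℕ}
    (hd : d ∈ (pderiv i P).support) : d + Finsupp.single i 1 ∈ P.support := by
  rw [mem_support_iff, coeff_pderiv] at hd
  exact mem_support_iff.2 (left_ne_zero_of_mul hd)

/-- Elements of the fraction field of a polynomial ring that are algebraic over the base field
are constants. -/
theorem exists_eq_C_of_isAlgebraic {F σ : Type*} [Field F] [Algebra (MvPolynomial σ K) F]
    [IsFractionRing (MvPolynomial σ K) F] [Algebra K F] [IsScalarTower K (MvPolynomial σ K) F]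
    {z : F} (hz : IsAlgebraic K z) : ∃ c : K, z = algebraMap K F c := by
  by_cases hz0 : z = 0
  · exact ⟨0, by rw [hz0, map_zero]⟩
  -- The polynomial ring is integrally closed, so both `z` and its inverse lie in it; its units are
  -- constants.
  have key : ∀ z : F, IsAlgebraic K z → ∃ p : MvPolynomial σ K, algebraMap _ F p = z :=
    fun z hz => IsIntegrallyClosed.isIntegral_iff.1 (hz.isIntegral.tower_top)
  obtain ⟨p, hp⟩ := key z hz
  obtain ⟨q, hq⟩ := key z⁻¹ hz.inv
  have hpq : p * q = 1 := by
    apply IsFractionRing.injective (MvPolynomial σ K) F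
    rw [map_mul, hp, hq, map_one, mul_inv_cancel₀ hz0]
  obtain ⟨c, -, hc⟩ := isUnit_iff_eq_C_of_isReduced.1 (IsUnit.of_mul_eq_one _ hpq)
  refine ⟨c, ?_⟩
  rw [← hp, hc, IsScalarTower.algebraMap_apply K (MvPolynomial σ K) F]
  rfl

/-- All monomials of `P` have the same weight for the weights 1, `m`. Dividing the relation by that
power of `u` leaves a one-variable equation over `K` for v/uᵐ, which is therefore a constant. -/
theorem exists_proportional_of_relation {a m k : ℕ} (ha : a ≠ 0) {P : PolyXY K} (hP0 : P ≠ 0)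
    (hP : IsWeightedHomogeneous (pairWeight a (a * m)) P (k : ℤ))
    {u v : PolyXY K} (hu : u ≠ 0) (hPu : aeval ![u, v] P = 0) :
    ∃ c : K, v = C c * u ^ m := by
  have aux : ∀ {F : Type _} [Field F] (c p r q : F), q ≠ 0 →
      c * (p * r) = p * q * (c * (r / q)) := by
    intro F _ c p r q hq
    field_simp
  let F := FractionRing (PolyXY K)
  let ι := algebraMap (PolyXY K) F
  have hι : Function.Injective ι := IsFractionRing.injective _ _
  have hu' : ι u ≠ 0 := by rwa [Ne, map_eq_zero_iff ι hι]
  set z : F := ι v / ι u ^ m with hz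
  obtain ⟨d, hd⟩ := support_nonempty.2 hP0
  have hsame : ∀ s ∈ P.support, s 0 + m * s 1 = d 0 + m * d 1 := by
    intro s hs
    have h := (hP.pair s hs).trans (hP.pair d hd).symm
    rw [mul_assoc, mul_assoc, ← mul_add, ← mul_add] at h
    exact Nat.eq_of_mul_eq_mul_left (Nat.pos_of_ne_zero ha) h
  have halg : IsAlgebraic K z := by
    refine ⟨∑ s ∈ P.support, Polynomial.monomial (s 1) (coeff s P), ?_, ?_⟩
    · intro h
      -- At fixed weight the exponent of y determines the monomial, so no two coefficients merge and
      -- the equation is nontrivial.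
      have h1 := congrArg (fun q => Polynomial.coeff q (d 1)) h
      simp only [Polynomial.finsetSum_coeff, Polynomial.coeff_monomial, Polynomial.coeff_zero]
        at h1
      rw [Finset.sum_eq_single_of_mem d hd, if_pos rfl] at h1
      · exact (mem_support_iff.1 hd) h1
      · intro s hs hsd
        rw [if_neg]
        intro h2
        have h3 := hsame s hs
        rw [h2] at h3
        apply hsd
        ext j
        fin_cases j
        · simpa using h3
        · exact h2
    · have h0 : ι (aeval ![u, v] P) = 0 := by rw [hPu, map_zero]
      rw [P.as_sum, map_sum, map_sum] at h0
      have h1 : ∀ s ∈ P.support, ι (aeval ![u, v] (monomial s (coeff s P))) =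
          ι u ^ (d 0 + m * d 1) * (algebraMap K F (coeff s P) * z ^ s 1) := by
        intro s hs
        rw [aeval_monomial_pair, ← hsame s hs, hz, map_mul, map_mul, map_pow, map_pow,
          IsScalarTower.algebraMap_apply K (PolyXY K) F, div_pow, pow_add, pow_mul]
        simp only [Matrix.cons_val_zero, Matrix.cons_val_one]
        have hq := pow_ne_zero (m * s 1) hu'
        rw [← pow_mul]
        change ι _ * (ι u ^ s 0 * ι v ^ s 1) =
          ι u ^ s 0 * ι u ^ (m * s 1) * (ι _ * (ι v ^ s 1 / ι u ^ (m * s 1)))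
        exact aux _ _ _ _ hq
      rw [Finset.sum_congr rfl h1, ← Finset.mul_sum] at h0
      rw [map_sum]
      simp only [Polynomial.aeval_monomial]
      exact (mul_eq_zero.1 h0).resolve_left (pow_ne_zero _ hu')
  obtain ⟨c, hc⟩ := exists_eq_C_of_isAlgebraic (σ := Fin 2) halg
  refine ⟨c, hι ?_⟩
  rw [hz, div_eq_iff (pow_ne_zero _ hu')] at hc
  rw [hc, map_mul, map_pow, IsScalarTower.algebraMap_apply K (PolyXY K) F]
  rfl

variable [CharZero K]

/-- Otherwise one element would generate K[x,y], whose transcendence degree is two. -/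
theorem LocNil.exists_nonconstant_ker {D : Derivation K (PolyXY K) (PolyXY K)} (hnil : LocNil D)
    (hD : D ≠ 0) : ∃ F : PolyXY K, D F = 0 ∧ ∀ c, F ≠ C c := by
  by_contra! h
  obtain ⟨r, hr⟩ := hnil.exists_aeval_surjective hD h
  have h1 := lift_trdeg_le_of_surjective (Polynomial.aeval r : Polynomial K →ₐ[K] _) hr
  rw [MvPolynomial.trdeg_of_isDomain, Polynomial.trdeg_of_isDomain] at h1
  simp at h1

theorem exists_leading_relation {D : Derivation K (PolyXY K) (PolyXY K)} (hnil : LocNil D)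
    (ha : nilDeg D hnil (X 0) ≠ 0) (hb : nilDeg D hnil (X 1) ≠ 0) :
    ∃ (E : Derivation K (PolyXY K) (PolyXY K)) (P : PolyXY K) (k : ℕ),
      LocNil E ∧ E ≠ 0 ∧ E P = 0 ∧ P ≠ 0 ∧ 0 < k ∧
      IsWeightedHomogeneous (pairWeight (nilDeg D hnil (X 0)) (nilDeg D hnil (X 1))) P k ∧
      aeval ![nilLead D hnil (X 0), nilLead D hnil (X 1)] P = 0 := by
  classical
  have hD : D ≠ 0 := by
    rintro rfl
    exact ha ((nilDeg_eq_zero_iff _ _).2 rfl)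
  set w := pairWeight (nilDeg D hnil (X 0)) (nilDeg D hnil (X 1)) with hw
  obtain ⟨e, he, he0⟩ := exists_topDerivation_ne_zero w hD
  obtain ⟨F, hF, hFc⟩ := hnil.exists_nonconstant_ker hD
  have hF0 : F ≠ 0 := fun h => hFc 0 (by rw [h, map_zero])
  obtain ⟨m, hm, hmax⟩ := Finset.exists_max_image F.support (Finsupp.weight w)
    (support_nonempty.2 hF0)
  obtain ⟨d, hd, hd0⟩ : ∃ d ∈ F.support, d ≠ 0 := by
    by_contra! h
    refine hFc (coeff 0 F) (MvPolynomial.ext _ _ fun d => ?_)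
    rw [coeff_C]
    split_ifs with h0
    · rw [h0]
    · by_contra h1
      exact h0 (h d (mem_support_iff.2 h1)).symm
  obtain ⟨k, hk⟩ : ∃ k : ℕ, Finsupp.weight w m = k := by
    refine ⟨nilDeg D hnil (X 0) * m 0 + nilDeg D hnil (X 1) * m 1, ?_⟩
    rw [weight_pairWeight]
    push_cast
    rfl
  -- Both weights are positive, so a nonconstant monomial has positive weight.
  have hkpos : 0 < k := by
    have h1 := hmax d hd
    rw [hk, weight_pairWeight] at h1
    by_contra! h2
    have h3 : nilDeg D hnil (X 0) * d 0 + nilDeg D hnil (X 1) * d 1 ≤ 0 :=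
      le_trans (by exact_mod_cast h1) h2
    apply hd0
    have h4 : d 0 = 0 := by simpa [ha] using (Nat.add_eq_zero_iff.1 (Nat.le_zero.1 h3)).1
    have h5 : d 1 = 0 := by simpa [hb] using (Nat.add_eq_zero_iff.1 (Nat.le_zero.1 h3)).2
    ext i
    fin_cases i
    · exact h4
    · exact h5
  have hFk : F ∈ weightLE K w k := mem_weightLE.2 fun d hd => hk ▸ hmax d hd
  refine ⟨topDerivation w e D, weightedHomogeneousComponent w k F, k,
    hnil.topDerivation he, he0, ?_, ?_, hkpos,
    weightedHomogeneousComponent_isWeightedHomogeneous _ _, ?_⟩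
  · rw [← (derivation_component he hFk).2, hF, map_zero]
  · intro h
    have h1 := congrArg (coeff m) h
    rw [coeff_weightedHomogeneousComponent, if_pos hk] at h1
    exact (mem_support_iff.1 hm) h1
  -- The exponential of `F` is constant in `T`, so its coefficient at `k > 0` vanishes.
  · have h1 := coeff_algHom_eq_aeval_component (expHom D hnil) le_rfl le_rfl hFk
    rw [expHom_eq_C D hnil hF, Polynomial.coeff_C_of_ne_zero hkpos.ne'] at h1
    exact h1.symm

theorem exponent_eq_zero_of_pderiv_eq_zero {i : Fin 2} {P : PolyXY K} (h : pderiv i P = 0) :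
    ∀ d ∈ P.support, d i = 0 := by
  intro d hd
  by_contra hdi
  have h1 : Finsupp.single i 1 ≤ d := by
    rw [Finsupp.single_le_iff]; omega
  have h2 := coeff_pderiv (i := i) P (d - Finsupp.single i 1)
  rw [h, tsub_add_cancel_of_le h1, coeff_zero] at h2
  rcases mul_eq_zero.1 h2.symm with h3 | h3
  · exact (mem_support_iff.1 hd) h3
  · exact Nat.cast_add_one_ne_zero _ h3

/-- If the variable divided `P`, factorial closedness of the kernel would put it in the kernel of
`E`. As `E ≠ 0`, the other partial derivative of `P` then vanishes, so `P` is a single monomial and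
cannot vanish at nonzero values. -/
theorem exists_pure_exponent {R : Type*} [CommRing R] [IsDomain R] [Algebra K R] {a b k : ℕ}
    (ha : a ≠ 0) (hb : b ≠ 0)
    {E : Derivation K (PolyXY K) (PolyXY K)} (hE : LocNil E) (hE0 : E ≠ 0) {P : PolyXY K}
    (hP0 : P ≠ 0) (hEP : E P = 0) (hP : IsWeightedHomogeneous (pairWeight a b) P (k : ℤ))
    {u : Fin 2 → R} (hu : ∀ i, u i ≠ 0) (hPu : aeval u P = 0) (i : Fin 2) :
    ∃ d ∈ P.support, d i = 0 := by
  by_contra! h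
  have hXE := hE.map_eq_zero_of_dvd_ker hEP hP0 (X_dvd_of_forall h)
  have hother : pderiv (1 - i) P = 0 := by
    have h1 := derivation_eq_pair E P
    fin_cases i
    · have h2 : E (X 1) ≠ 0 := fun h2 => hE0 (derivation_eq_zero_pair hXE h2)
      simp only [Fin.zero_eta] at hXE
      rw [hEP, hXE, mul_zero, zero_add] at h1
      exact (mul_eq_zero.1 h1.symm).resolve_right h2
    · have h2 : E (X 0) ≠ 0 := fun h2 => hE0 (derivation_eq_zero_pair h2 hXE)
      simp only [Fin.mk_one] at hXE
      rw [hEP, hXE, mul_zero, add_zero] at h1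
      exact (mul_eq_zero.1 h1.symm).resolve_right h2
  have hz := exponent_eq_zero_of_pderiv_eq_zero hother
  obtain ⟨d, hd⟩ := support_nonempty.2 hP0
  have huniq : ∀ m ∈ P.support, m = d := by
    intro m hm
    have e1 := hP.pair m hm
    have e2 := hP.pair d hd
    have z1 := hz m hm
    have z2 := hz d hd
    ext j
    fin_cases i
    · simp at z1 z2
      rw [z1] at e1
      rw [z2] at e2
      fin_cases j
      · exact Nat.eq_of_mul_eq_mul_left (Nat.pos_of_ne_zero ha) (by simpa using e1.trans e2.symm)
      · exact z1.trans z2.symm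
    · simp at z1 z2
      rw [z1] at e1
      rw [z2] at e2
      fin_cases j
      · exact z1.trans z2.symm
      · exact Nat.eq_of_mul_eq_mul_left (Nat.pos_of_ne_zero hb) (by simpa using e1.trans e2.symm)
  rw [P.as_sum, Finset.sum_eq_single_of_mem d hd
    (fun m hm hmd => absurd (huniq m hm) hmd), aeval_monomial_pair] at hPu
  have hc : algebraMap K R (coeff d P) ≠ 0 := by
    rw [Ne, FaithfulSMul.algebraMap_eq_zero_iff]
    exact mem_support_iff.1 hd
  exact mul_ne_zero hc (mul_ne_zero (pow_ne_zero _ (hu 0)) (pow_ne_zero _ (hu 1))) hPu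

theorem not_X_dvd_pderiv {i j : Fin 2} {P : PolyXY K} {d : Fin 2 →₀ ℕ}
    (hd : d ∈ P.support) (hi : d i ≠ 0) (hj : d j = 0) : ¬ (X j : PolyXY K) ∣ pderiv i P := by
  intro h
  have h1 : Finsupp.single i 1 ≤ d := by
    rw [Finsupp.single_le_iff]; omega
  refine ne_zero_of_X_dvd h (d - Finsupp.single i 1) ?_ ?_
  · rw [mem_support_iff, coeff_pderiv, tsub_add_cancel_of_le h1]
    exact mul_ne_zero (mem_support_iff.1 hd) (Nat.cast_add_one_ne_zero _)
  · simp [hj]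

/-- Without divisibility, ∂P/∂x is divisible by x but not y, and ∂P/∂y by y but not x. Then `E P =
0` makes y divide E(x) and x divide E(y), which a nonzero locally nilpotent `E` does not allow here.
-/
theorem dvd_or_dvd_of_relation {R : Type*} [CommRing R] [IsDomain R] [Algebra K R] {a b k : ℕ}
    (ha : a ≠ 0) (hb : b ≠ 0) (hk : 0 < k)
    {E : Derivation K (PolyXY K) (PolyXY K)} (hE : LocNil E) (hE0 : E ≠ 0) {P : PolyXY K}
    (hP0 : P ≠ 0) (hEP : E P = 0) (hP : IsWeightedHomogeneous (pairWeight a b) P (k : ℤ))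
    {u : Fin 2 → R} (hu : ∀ i, u i ≠ 0) (hPu : aeval u P = 0) : a ∣ b ∨ b ∣ a := by
  by_contra! hab
  obtain ⟨d, hd, hd1⟩ := exists_pure_exponent ha hb hE hE0 hP0 hEP hP hu hPu 1
  obtain ⟨m, hm, hm0⟩ := exists_pure_exponent ha hb hE hE0 hP0 hEP hP hu hPu 0
  have ed := hP.pair d hd
  have em := hP.pair m hm
  rw [hd1, mul_zero, add_zero] at ed
  rw [hm0, mul_zero, zero_add] at em
  have hd0 : d 0 ≠ 0 := by rintro h; rw [h] at ed; omega
  have hm1 : m 1 ≠ 0 := by rintro h; rw [h] at em; omega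
  -- A monomial of ∂P/∂y free of y comes from one of `P` linear in y; comparing its weight with that
  -- of the pure power of x gives `a ∣ b`.
  have hy : (X 1 : PolyXY K) ∣ pderiv 1 P := X_dvd_of_forall fun s hs hs1 => by
    have := hP.pair _ (exponent_of_mem_support_pderiv hs)
    simp [hs1] at this
    refine hab.1 ((Nat.dvd_add_right (dvd_mul_right a (s 0))).1 ?_)
    rw [this, ← ed]
    exact dvd_mul_right _ _
  have hx : (X 0 : PolyXY K) ∣ pderiv 0 P := X_dvd_of_forall fun s hs hs1 => by
    have := hP.pair _ (exponent_of_mem_support_pderiv hs)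
    simp [hs1] at this
    refine hab.2 ((Nat.dvd_add_left (dvd_mul_right b (s 1))).1 ?_)
    rw [this, ← em]
    exact dvd_mul_right _ _
  have hy' := not_X_dvd_pderiv hd hd0 hd1
  have hx' := not_X_dvd_pderiv hm hm1 hm0
  have hrel := derivation_eq_pair E P
  rw [hEP] at hrel
  have h1 : (X 1 : PolyXY K) ∣ E (X 0) := by
    refine (X_prime.dvd_or_dvd ?_).resolve_left hy'
    refine (dvd_add_left (hy.mul_right (E (X 1)))).1 ?_
    rw [← hrel]
    exact dvd_zero _
  have h0 : (X 0 : PolyXY K) ∣ E (X 1) := by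
    refine (X_prime.dvd_or_dvd ?_).resolve_left hx'
    refine (dvd_add_right (hx.mul_right (E (X 0)))).1 ?_
    rw [← hrel]
    exact dvd_zero _
  rcases hE.map_eq_zero_or_of_dvd h0 h1 with h | h
  · rw [h, mul_zero, zero_add] at hrel
    rcases mul_eq_zero.1 hrel.symm with h2 | h2
    · exact hx' (h2 ▸ dvd_zero _)
    · exact hE0 (derivation_eq_zero_pair h h2)
  · rw [h, mul_zero, add_zero] at hrel
    rcases mul_eq_zero.1 hrel.symm with h2 | h2
    · exact hy' (h2 ▸ dvd_zero _)
    · exact hE0 (derivation_eq_zero_pair h2 h)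

end Leading

/-! ### The grading modulo n. -/

section Grading

variable {K : Type*} [Field K] {n : ℕ}

/-- Polynomials all of whose monomials have total degree congruent to `r` modulo `n`. -/
abbrev IsModHomogeneous (n : ℕ) (r : ZMod n) (p : PolyXY K) : Prop :=
  IsWeightedHomogeneous (fun _ => (1 : ZMod n)) p r

theorem weight_one_zmod (d : Fin 2 →₀ ℕ) :
    Finsupp.weight (fun _ => (1 : ZMod n)) d = ((d 0 + d 1 : ℕ) : ZMod n) := by
  rw [Finsupp.weight_apply, Finsupp.sum_fintype _ _ (by simp)]
  simp [Fin.sum_univ_two]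

theorem mem_gradedPart_one_iff (hn : 2 ≤ n) {p : PolyXY K} :
    p ∈ gradedPart K n 1 ↔ IsModHomogeneous n 1 p := by
  constructor
  · intro h
    have hle : gradedPart K n 1 ≤ weightedHomogeneousSubmodule K (fun _ => (1 : ZMod n)) 1 := by
      refine Submodule.span_le.2 ?_
      rintro _ ⟨a, b, s, hs, rfl⟩
      have h := ((isWeightedHomogeneous_X K (fun _ => (1 : ZMod n)) (0 : Fin 2)).pow a).mul
        ((isWeightedHomogeneous_X K (fun _ => (1 : ZMod n)) (1 : Fin 2)).pow b)
      have h2 : a • (1 : ZMod n) + b • (1 : ZMod n) = 1 := by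
        have := congrArg (Nat.cast : ℕ → ZMod n) hs
        simpa using this
      rw [h2] at h
      exact h
    exact hle h
  · intro h
    rw [p.as_sum]
    refine Submodule.sum_mem _ fun d hd => ?_
    have hd1 := h (mem_support_iff.1 hd)
    rw [weight_one_zmod] at hd1
    have hmod : 1 ≡ d 0 + d 1 [MOD n] := by
      rw [← ZMod.natCast_eq_natCast_iff, hd1, Nat.cast_one]
    -- Here `n ≥ 2` matters: degree 0 is not congruent to 1, so `s` can be taken nonnegative.
    have hpos : 1 ≤ d 0 + d 1 := by
      by_contra! h0
      have h1 : d 0 + d 1 = 0 := by omega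
      rw [h1, Nat.ModEq, Nat.mod_eq_of_lt hn, Nat.zero_mod] at hmod
      omega
    obtain ⟨s, hs⟩ := (Nat.modEq_iff_dvd' hpos).1 hmod
    have hmon : monomial d (coeff d p) = coeff d p • ((X 0 : PolyXY K) ^ d 0 * X 1 ^ d 1) := by
      rw [monomial_eq, Finsupp.prod_fintype _ _ (by simp), Fin.prod_univ_two, C_mul']
    rw [hmon]
    exact Submodule.smul_mem _ _ (Submodule.subset_span ⟨d 0, d 1, s, by omega, rfl⟩)

theorem IsModHomogeneous.map_derivation {D : Derivation K (PolyXY K) (PolyXY K)}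
    (hD : ∀ i, IsModHomogeneous n 1 (D (X i))) {r : ZMod n} {p : PolyXY K}
    (hp : IsModHomogeneous n r p) : IsModHomogeneous n r (D p) := by
  rw [derivation_eq_sum_pderiv]
  refine IsWeightedHomogeneous.sum _ _ _ fun i _ => ?_
  have h := (hp.pderiv (i := i) (n' := r - 1) (by simp)).mul (hD i)
  rwa [sub_add_cancel] at h

theorem IsModHomogeneous.map_algHom {ψ : PolyXY K →ₐ[K] PolyXY K}
    (hψ : ∀ i, IsModHomogeneous n 1 (ψ (X i))) {r : ZMod n} {p : PolyXY K}
    (hp : IsModHomogeneous n r p) : IsModHomogeneous n r (ψ p) := by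
  rw [aeval_unique ψ, p.as_sum, map_sum]
  refine IsWeightedHomogeneous.sum _ _ _ fun d hd => ?_
  have hr := hp (mem_support_iff.1 hd)
  rw [aeval_monomial_pair]
  refine IsWeightedHomogeneous.C_mul ?_ _
  have h := ((hψ 0).pow (d 0)).mul ((hψ 1).pow (d 1))
  rw [weight_one_zmod] at hr
  have h2 : d 0 • (1 : ZMod n) + d 1 • (1 : ZMod n) = r := by
    rw [← hr]; simp
  rw [h2] at h
  exact h

theorem isGradedAut_iff (hn : 2 ≤ n) {φ : PolyXY K ≃ₐ[K] PolyXY K} :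
    IsGradedAut n φ ↔ ∀ i, IsModHomogeneous n 1 (φ (X i)) := by
  rw [IsGradedAut, mem_gradedPart_one_iff hn, mem_gradedPart_one_iff hn, Fin.forall_fin_two]

theorem isGradedDerivation_iff (hn : 2 ≤ n) {D : Derivation K (PolyXY K) (PolyXY K)} :
    IsGradedDerivation n D ↔ ∀ i, IsModHomogeneous n 1 (D (X i)) := by
  rw [IsGradedDerivation, mem_gradedPart_one_iff hn, mem_gradedPart_one_iff hn,
    Fin.forall_fin_two]

/-- The monoid of products of graded elementary automorphisms. -/
abbrev gradedTame (K : Type*) [Field K] (n : ℕ) : Submonoid (PolyXY K ≃ₐ[K] PolyXY K) :=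
  Submonoid.closure {ε | IsElementaryAut ε ∧ IsGradedAut n ε}

theorem isGradedTameAut_of_mem (hn : 2 ≤ n) {φ : PolyXY K ≃ₐ[K] PolyXY K}
    (h : φ ∈ gradedTame K n) : IsGradedTameAut n φ := by
  refine ⟨?_, h⟩
  refine Submonoid.closure_induction (motive := fun φ _ => IsGradedAut n φ) (fun φ hφ => hφ.2) ?_ ?_ h
  · rw [isGradedAut_iff hn]
    exact fun i => isWeightedHomogeneous_X K _ i
  · intro φ ψ _ _ hφ hψ
    rw [isGradedAut_iff hn] at hφ hψ ⊢
    exact fun i => IsModHomogeneous.map_algHom (ψ := φ.toAlgHom) hφ (hψ i)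

end Grading

/-! ### Shears and the swap as graded tame automorphisms. -/

section Automorphisms

variable {K : Type*} [Field K]

/-- The automorphism `(x, y + c xᵐ)`. -/
def shear (c : K) (m : ℕ) : PolyXY K ≃ₐ[K] PolyXY K :=
  AlgEquiv.ofAlgHom (aeval ![X 0, X 1 + C c * X 0 ^ m]) (aeval ![X 0, X 1 - C c * X 0 ^ m])
    (by
      apply algHom_ext
      intro i
      fin_cases i <;> simp [algebraMap_eq])
    (by
      apply algHom_ext
      intro i
      fin_cases i <;> simp [algebraMap_eq])

theorem shear_X_zero (c : K) (m : ℕ) : shear c m (X 0) = X 0 := by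
  simp [shear]

theorem shear_X_one (c : K) (m : ℕ) : shear c m (X 1) = X 1 + C c * X 0 ^ m := by
  simp [shear]

theorem shear_symm_X_zero (c : K) (m : ℕ) : (shear c m).symm (X 0) = X 0 := by
  simp [shear]

theorem shear_symm_X_one (c : K) (m : ℕ) : (shear c m).symm (X 1) = X 1 - C c * X 0 ^ m := by
  simp [shear]

/-- The automorphism exchanging the variables. -/
def swapXY (K : Type*) [Field K] : PolyXY K ≃ₐ[K] PolyXY K := renameEquiv K (Equiv.swap 0 1)

theorem swapXY_X_zero : swapXY K (X 0) = X 1 := by simp [swapXY]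

theorem swapXY_X_one : swapXY K (X 1) = X 0 := by simp [swapXY]

theorem swapXY_symm : (swapXY K).symm = swapXY K := by
  simp [swapXY]

/-- The automorphism `(y - x, y)`. -/
def reflectX (K : Type*) [Field K] : PolyXY K ≃ₐ[K] PolyXY K :=
  AlgEquiv.ofAlgHom (aeval ![X 1 - X 0, X 1]) (aeval ![X 1 - X 0, X 1])
    (by
      apply algHom_ext
      intro i
      fin_cases i <;> simp)
    (by
      apply algHom_ext
      intro i
      fin_cases i <;> simp)

/-- The swap is not elementary; this linear factorization, graded for every `n`, shows that it is
tame. -/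
theorem swapXY_eq : swapXY K = shear 1 1 * (reflectX K * shear (-1) 1) := by
  apply AlgEquiv.coe_toAlgHom_injective
  apply algHom_ext
  intro i
  fin_cases i
  · simp [swapXY, reflectX, shear]
  · simp [swapXY, reflectX, shear]

variable {n : ℕ}

theorem shear_graded (c : K) {m : ℕ} (hm : (m : ZMod n) = 1) (i : Fin 2) :
    IsModHomogeneous n 1 (shear c m (X i)) ∧ IsModHomogeneous n 1 ((shear c m).symm (X i)) := by
  have h0 := isWeightedHomogeneous_X K (fun _ => (1 : ZMod n)) (0 : Fin 2)
  have h1 := isWeightedHomogeneous_X K (fun _ => (1 : ZMod n)) (1 : Fin 2)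
  have h2 := (h0.pow m).C_mul c
  rw [nsmul_one, hm] at h2
  fin_cases i
  · exact ⟨(shear_X_zero c m).symm ▸ h0, (shear_symm_X_zero c m).symm ▸ h0⟩
  · exact ⟨(shear_X_one c m).symm ▸ h1.add h2, (shear_symm_X_one c m).symm ▸ h1.sub h2⟩

theorem shear_mem_gradedTame (hn : 2 ≤ n) (c : K) {m : ℕ} (hm : (m : ZMod n) = 1) :
    shear c m ∈ gradedTame K n := by
  refine Submonoid.subset_closure ⟨⟨1, Polynomial.monomial m c, one_ne_zero, Or.inl
    ⟨shear_X_zero c m, ?_⟩⟩, (isGradedAut_iff hn).2 fun i => (shear_graded c hm i).1⟩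
  rw [shear_X_one, Polynomial.aeval_monomial, map_one, one_mul, algebraMap_eq]

theorem swapXY_graded (i : Fin 2) : IsModHomogeneous n 1 (swapXY K (X i)) := by
  fin_cases i
  · exact swapXY_X_zero (K := K).symm ▸ isWeightedHomogeneous_X K _ _
  · exact swapXY_X_one (K := K).symm ▸ isWeightedHomogeneous_X K _ _

theorem swapXY_mem_gradedTame (hn : 2 ≤ n) : swapXY K ∈ gradedTame K n := by
  rw [swapXY_eq]
  refine mul_mem (shear_mem_gradedTame hn 1 (by simp))
    (mul_mem (Submonoid.subset_closure ⟨⟨-1, Polynomial.X, by simp, Or.inr ⟨?_, ?_⟩⟩, ?_⟩)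
      (shear_mem_gradedTame hn (-1) (by simp)))
  · simp [reflectX]
    ring
  · simp [reflectX]
  · rw [isGradedAut_iff hn]
    have h0 := isWeightedHomogeneous_X K (fun _ => (1 : ZMod n)) (0 : Fin 2)
    have h1 := isWeightedHomogeneous_X K (fun _ => (1 : ZMod n)) (1 : Fin 2)
    intro i
    fin_cases i
    · simpa [reflectX] using h1.sub h0
    · simpa [reflectX] using h1

end Automorphisms

/-! ### Conjugation and the induction on degrees. -/

section Conjugation

variable {K : Type*} [Field K]

/-- The derivation `β⁻¹ D β`. -/
def conjDerivation (β : PolyXY K ≃ₐ[K] PolyXY K) (D : Derivation K (PolyXY K) (PolyXY K)) :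
    Derivation K (PolyXY K) (PolyXY K) :=
  Derivation.mk' (β.symm.toLinearMap ∘ₗ D.toLinearMap ∘ₗ β.toLinearMap) fun p q => by
    simp [D.leibniz]

theorem conjDerivation_apply (β : PolyXY K ≃ₐ[K] PolyXY K)
    (D : Derivation K (PolyXY K) (PolyXY K)) (p : PolyXY K) :
    conjDerivation β D p = β.symm (D (β p)) := rfl

theorem iterate_conjDerivation (β : PolyXY K ≃ₐ[K] PolyXY K)
    (D : Derivation K (PolyXY K) (PolyXY K)) (j : ℕ) (p : PolyXY K) :
    (conjDerivation β D)^[j] p = β.symm (D^[j] (β p)) := by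
  induction j with
  | zero => simp
  | succ j ih => simp [Function.iterate_succ_apply', ih, conjDerivation_apply]

theorem LocNil.conjDerivation {D : Derivation K (PolyXY K) (PolyXY K)} (hD : LocNil D)
    (β : PolyXY K ≃ₐ[K] PolyXY K) : LocNil (conjDerivation β D) := fun p => by
  obtain ⟨m, hm⟩ := hD (β p)
  exact ⟨m, by rw [iterate_conjDerivation, hm, map_zero]⟩

theorem conjDerivation_graded {n : ℕ} {D : Derivation K (PolyXY K) (PolyXY K)}
    {β : PolyXY K ≃ₐ[K] PolyXY K} (hD : ∀ i, IsModHomogeneous n 1 (D (X i)))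
    (hβ : ∀ i, IsModHomogeneous n 1 (β (X i)))
    (hβ' : ∀ i, IsModHomogeneous n 1 (β.symm (X i))) (i : Fin 2) :
    IsModHomogeneous n 1 (conjDerivation β D (X i)) :=
  IsModHomogeneous.map_algHom (ψ := β.symm.toAlgHom) hβ'
    (IsModHomogeneous.map_derivation hD (hβ i))

/-- `D` is conjugate to some `f(y) ∂ₓ` by a graded tame automorphism. -/
def IsTamelyTriangular (n : ℕ) (D : Derivation K (PolyXY K) (PolyXY K)) : Prop :=
  ∃ α ∈ gradedTame K n, ∃ f ∈ gradedPartY K n,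
    ∀ p : PolyXY K, α⁻¹ (D (α p)) = (f • pderiv (0 : Fin 2)) p

theorem IsTamelyTriangular.of_conj {n : ℕ} {D : Derivation K (PolyXY K) (PolyXY K)}
    {β : PolyXY K ≃ₐ[K] PolyXY K} (hβ : β ∈ gradedTame K n)
    (h : IsTamelyTriangular n (conjDerivation β D)) : IsTamelyTriangular n D := by
  obtain ⟨α, hα, f, hf, hp⟩ := h
  refine ⟨β * α, mul_mem hβ hα, f, hf, fun p => ?_⟩
  rw [← hp p, mul_inv_rev]
  rfl

variable [CharZero K]

/-- The two exponentials differ by applying `β⁻¹` to coefficients, which preserves degree. -/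
theorem nilDeg_conjDerivation {D : Derivation K (PolyXY K) (PolyXY K)} (hD : LocNil D)
    (β : PolyXY K ≃ₐ[K] PolyXY K) (p : PolyXY K) :
    nilDeg (conjDerivation β D) (hD.conjDerivation β) p = nilDeg D hD (β p) := by
  have h : expHom (conjDerivation β D) (hD.conjDerivation β) p =
      (expHom D hD (β p)).map (β.symm : PolyXY K →+* PolyXY K) := by
    ext1 i
    rw [Polynomial.coeff_map, coeff_expHom, coeff_expHom, iterate_conjDerivation]
    exact (map_smul β.symm _ _).symm
  rw [nilDeg, h, Polynomial.natDegree_map_eq_of_injective]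
  · rfl
  · exact β.symm.injective

/-- A locally nilpotent derivation killing `y` has the form `f(y) ∂ₓ`. -/
theorem IsTamelyTriangular.of_map_X_one_eq_zero {n : ℕ} (hn : 2 ≤ n)
    {D : Derivation K (PolyXY K) (PolyXY K)} (hnil : LocNil D)
    (hD : ∀ i, IsModHomogeneous n 1 (D (X i))) (h1 : D (X 1) = 0) : IsTamelyTriangular n D := by
  refine ⟨1, one_mem _, D (X 0), ⟨(mem_gradedPart_one_iff hn).2 (hD 0), ?_⟩, fun p => ?_⟩
  -- `D x` divides its own derivative, so it is in the kernel; hence it does not involve x.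
  · have hself : D (D (X 0)) = D (X 0) * pderiv 0 (D (X 0)) := by
      rw [derivation_eq_pair D (D (X 0)), h1, mul_zero, add_zero, mul_comm]
    have h0 := hnil.map_eq_zero_of_dvd hself
    have hpd : pderiv 0 (D (X 0)) = 0 := by
      rw [hself] at h0
      rcases mul_eq_zero.1 h0 with h | h
      · rw [h, map_zero]
      · exact h
    have hsupp : D (X 0) ∈ supported K {(1 : Fin 2)} := by
      rw [mem_supported]
      intro i hi
      obtain ⟨d, hd, hid⟩ := (mem_vars_iff_mem_support i).1 hi
      have := exponent_eq_zero_of_pderiv_eq_zero hpd d hd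
      fin_cases i
      · simp [this] at hid
      · rfl
    rw [supported_eq_adjoin_X, Set.image_singleton] at hsupp
    exact hsupp
  · change D p = _
    rw [derivation_eq_pair D p, h1, mul_zero, add_zero, mul_comm]
    rfl

theorem nilLead_graded {n : ℕ} {D : Derivation K (PolyXY K) (PolyXY K)} (hnil : LocNil D)
    (hD : ∀ i, IsModHomogeneous n 1 (D (X i))) {r : ZMod n} {p : PolyXY K}
    (hp : IsModHomogeneous n r p) : IsModHomogeneous n r (nilLead D hnil p) := by
  have h : ∀ j, IsModHomogeneous n r (D^[j] p) := by
    intro j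
    induction j with
    | zero => exact hp
    | succ j ih =>
      rw [Function.iterate_succ_apply']
      exact IsModHomogeneous.map_derivation hD ih
  rw [nilLead_eq, ← C_mul']
  exact IsWeightedHomogeneous.C_mul (h _) _

/-- If the degree of `x` divides the degree of `y`, a graded shear lowers the degree of `y`. -/
theorem exists_shear_nilDeg_lt {n : ℕ} {D : Derivation K (PolyXY K) (PolyXY K)} (hnil : LocNil D)
    (hD : ∀ i, IsModHomogeneous n 1 (D (X i))) (ha : nilDeg D hnil (X 0) ≠ 0)
    (hb : nilDeg D hnil (X 1) ≠ 0) (hab : nilDeg D hnil (X 0) ∣ nilDeg D hnil (X 1)) :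
    ∃ (c : K) (m : ℕ), (m : ZMod n) = 1 ∧
      nilDeg D hnil (X 1 + C c * X 0 ^ m) < nilDeg D hnil (X 1) := by
  obtain ⟨E, P, k, -, -, -, hP0, -, hP, hPu⟩ := exists_leading_relation hnil ha hb
  obtain ⟨m, hm⟩ := hab
  rw [hm] at hP
  have hu := nilLead_ne_zero D hnil (X_ne_zero (R := K) (0 : Fin 2))
  have hv := nilLead_ne_zero D hnil (X_ne_zero (R := K) (1 : Fin 2))
  obtain ⟨c, hc⟩ := exists_proportional_of_relation ha hP0 hP hu hPu
  have hc0 : C c ≠ (0 : PolyXY K) := left_ne_zero_of_mul (hc ▸ hv)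
  refine ⟨-c, m, ?_, ?_⟩
  -- The nonzero element v = c uᵐ is homogeneous of class 1 and of class `m`.
  · have h1 := nilLead_graded hnil hD (isWeightedHomogeneous_X K _ (1 : Fin 2))
    have h2 := ((nilLead_graded hnil hD (isWeightedHomogeneous_X K _ (0 : Fin 2))).pow m).C_mul c
    rw [← hc, nsmul_one] at h2
    exact IsWeightedHomogeneous.inj_right hv h2 h1
  · have hx : expHom D hnil (X 0) ≠ 0 := (expHom_eq_zero_iff D hnil).not.2 (X_ne_zero _)
    have hy : expHom D hnil (X 1) ≠ 0 := (expHom_eq_zero_iff D hnil).not.2 (X_ne_zero _)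
    have hE : expHom D hnil (X 1 + C (-c) * X 0 ^ m) =
        expHom D hnil (X 1) - Polynomial.C (C c) * expHom D hnil (X 0) ^ m := by
      rw [map_add, map_mul, map_pow, expHom_eq_C D hnil (derivation_C D (-c)), map_neg, map_neg]
      ring
    have hC : Polynomial.C (C c : PolyXY K) ≠ 0 := Polynomial.C_ne_zero.2 hc0
    have hdeg : (Polynomial.C (C c) * expHom D hnil (X 0) ^ m).natDegree =
        nilDeg D hnil (X 1) := by
      rw [Polynomial.natDegree_mul hC (pow_ne_zero _ hx), Polynomial.natDegree_C, zero_add,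
        Polynomial.natDegree_pow, hm, mul_comm]
      rfl
    have hlt : (expHom D hnil (X 1 + C (-c) * X 0 ^ m)).degree < (expHom D hnil (X 1)).degree := by
      rw [hE]
      apply Polynomial.degree_sub_lt_left _ hy
      · rw [Polynomial.leadingCoeff_mul, Polynomial.leadingCoeff_C, Polynomial.leadingCoeff_pow]
        exact hc
      · rw [Polynomial.degree_eq_natDegree hy,
          Polynomial.degree_eq_natDegree (mul_ne_zero hC (pow_ne_zero _ hx)), hdeg]
        rfl
    -- The zero polynomial has `natDegree` 0, so this case needs the degree of y to be positive.
    by_cases h0 : expHom D hnil (X 1 + C (-c) * X 0 ^ m) = 0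
    · rw [nilDeg, h0, Polynomial.natDegree_zero]
      exact Nat.pos_of_ne_zero hb
    · exact Polynomial.natDegree_lt_natDegree h0 hlt

/-- Rentschler's theorem for graded derivations. -/
theorem isTamelyTriangular_of_locNil {n : ℕ} (hn : 2 ≤ n)
    {D : Derivation K (PolyXY K) (PolyXY K)} (hnil : LocNil D)
    (hD : ∀ i, IsModHomogeneous n 1 (D (X i))) : IsTamelyTriangular n D := by
  obtain ⟨N, hN⟩ : ∃ N, N = nilDeg D hnil (X 0) + nilDeg D hnil (X 1) := ⟨_, rfl⟩
  induction N using Nat.strong_induction_on generalizing D with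
  | _ N ih =>
    have hswap : ∀ D : Derivation K (PolyXY K) (PolyXY K),
        (∀ i, IsModHomogeneous n 1 (D (X i))) →
        ∀ i, IsModHomogeneous n 1 (conjDerivation (swapXY K) D (X i)) := fun D hD =>
      conjDerivation_graded hD swapXY_graded (by rw [swapXY_symm]; exact swapXY_graded)
    -- Stated for every derivation with degree sum `N`, since the swap preserves the sum and is
    -- followed by this same reduction.
    have step : ∀ D : Derivation K (PolyXY K) (PolyXY K), ∀ hnil : LocNil D,
        (∀ i, IsModHomogeneous n 1 (D (X i))) →
        N = nilDeg D hnil (X 0) + nilDeg D hnil (X 1) → nilDeg D hnil (X 0) ≠ 0 →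
        nilDeg D hnil (X 1) ≠ 0 → nilDeg D hnil (X 0) ∣ nilDeg D hnil (X 1) →
        IsTamelyTriangular n D := by
      intro D hnil hD hN ha hb hab
      obtain ⟨c, m, hm, hlt⟩ := exists_shear_nilDeg_lt hnil hD ha hb hab
      refine IsTamelyTriangular.of_conj (shear_mem_gradedTame hn c hm)
        (ih _ ?_ (hnil.conjDerivation _) (conjDerivation_graded hD
          (fun i => (shear_graded c hm i).1) fun i => (shear_graded c hm i).2) rfl)
      rw [nilDeg_conjDerivation hnil, nilDeg_conjDerivation hnil, shear_X_zero, shear_X_one]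
      omega
    by_cases hb : nilDeg D hnil (X 1) = 0
    · exact .of_map_X_one_eq_zero hn hnil hD ((nilDeg_eq_zero_iff D hnil).1 hb)
    by_cases ha : nilDeg D hnil (X 0) = 0
    · refine IsTamelyTriangular.of_conj (swapXY_mem_gradedTame hn)
        (.of_map_X_one_eq_zero hn (hnil.conjDerivation _) (hswap D hD) ?_)
      rw [conjDerivation_apply, swapXY_X_one, (nilDeg_eq_zero_iff D hnil).1 ha, map_zero]
    obtain ⟨E, P, k, hE, hE0, hEP, hP0, hk, hP, hPu⟩ := exists_leading_relation hnil ha hb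
    have hu : ∀ i, ![nilLead D hnil (X 0), nilLead D hnil (X 1)] i ≠ 0 := by
      rw [Fin.forall_fin_two]
      exact ⟨nilLead_ne_zero D hnil (X_ne_zero _), nilLead_ne_zero D hnil (X_ne_zero _)⟩
    rcases dvd_or_dvd_of_relation ha hb hk hE hE0 hP0 hEP hP hu hPu with hab | hab
    · exact step D hnil hD hN ha hb hab
    · have h0 := nilDeg_conjDerivation hnil (swapXY K) (X 0)
      have h1 := nilDeg_conjDerivation hnil (swapXY K) (X 1)
      rw [swapXY_X_zero] at h0
      rw [swapXY_X_one] at h1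
      exact .of_conj (swapXY_mem_gradedTame hn) (step _ (hnil.conjDerivation _) (hswap D hD)
        (by rw [h0, h1, hN, add_comm]) (by rwa [h0]) (by rwa [h1]) (by rwa [h0, h1]))

end Conjugation

end

theorem proposition2 {K : Type*} [Field K] [CharZero K] (n : ℕ) (hn : 2 ≤ n)
    (D : Derivation K (PolyXY K) (PolyXY K))
    (hD : IsGradedDerivation n D) (hnil : IsLocallyNilpotentDerivation D) :
    ∃ α : PolyXY K ≃ₐ[K] PolyXY K, IsGradedTameAut n α ∧
      ∃ f ∈ gradedPartY K n,
        ∀ p : PolyXY K, α⁻¹ (D (α p)) = (f • MvPolynomial.pderiv (0 : Fin 2)) p := by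
  have hnil' : LocNil D := fun p => by
    obtain ⟨m, -, hm⟩ := hnil p
    exact ⟨m, hm⟩
  obtain ⟨α, hα, h⟩ := isTamelyTriangular_of_locNil hn hnil' ((isGradedDerivation_iff hn).1 hD)
  exact ⟨α, isGradedTameAut_of_mem hn hα, h⟩
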